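/- Let $R$ be an associative ring with unit and let $M$ be a left unital $R$-module. A submodule $N$ of $M$ is called small in $M$ if $N+K=M$ implies $K=M$ for every submodule $K$ of $M$, and $\mathrm{Rad}(M)$ denotes the sum of all small submodules of $M$. The module $M$ has property $AB5^{*}$ if $$N+\bigcap_{i\in I}M_i=\bigcap_{i\in I}(N+M_i)$$ for every submodule $N$ of $M$ and every inverse system (downward directed family) $\{M_i\}_{i\in I}$ of submodules of $M$. The Krull dimension of a left $R$-module $X$, if it exists, is defined by transfinite recursion: $k(X)=-1$ if and only if $X=0$; and for an ordinal $\alpha\ge 0$, $k(X)=\alpha$ if and only if $k(X)\not<\alpha$ and for every descending chain $X_0\supseteq X_1\supseteq X_2\supseteq\cdots$ of submodules of $X$ there is an $n$ such that $k(X_i/X_{i+1})$ exists and $k(X_i/X_{i+1})<\alpha$ for all $i\ge n$. The module $X$ has Krull dimension if $k(X)=\alpha$ for $\alpha=-1$ or some ordinal $\alpha$. **Theorem.** Let $M$ be a left $R$-module having $AB5^{*}$ such that every small submodule of $M$ has Krull dimension. Then $\mathrm{Rad}(M)$ has Krull dimension. -/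

import Mathlib

universe u v

/-- A submodule `N` of `M` is small (superfluous), `N ≪ M`, if `N + K = M` holds for a submodule
`K` only when `K = M`. -/
def IsSmallSubmodule {R : Type u} {M : Type v} [Ring R] [AddCommGroup M] [Module R M]
    (N : Submodule R M) : Prop :=
  ∀ K : Submodule R M, N ⊔ K = ⊤ → K = ⊤

/-- The radical `Rad(M)`: the sum of all small submodules of `M`. -/
def moduleRad (R : Type u) (M : Type v) [Ring R] [AddCommGroup M] [Module R M] :
    Submodule R M :=
  sSup {N : Submodule R M | IsSmallSubmodule N}

/-- Property `AB5*`: `N + ⋂ Mᵢ = ⋂ (N + Mᵢ)` for every submodule `N` and every inverse system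
(that is, downward directed family) of submodules `Mᵢ`. Both sides depend only on the set of
members of the family, so directed sets of submodules are used. -/
def HasAB5Star (R : Type u) (M : Type v) [Ring R] [AddCommGroup M] [Module R M] : Prop :=
  ∀ (N : Submodule R M) (S : Set (Submodule R M)), DirectedOn (· ≥ ·) S →
    N ⊔ sInf S = ⨅ X ∈ S, N ⊔ X

/-- `IsModuleKrullDim R α M` says that the (Gabriel–Rentschler) Krull dimension of `M` exists and
is equal to `α`, where `⊥` stands for `-1`. It is defined by transfinite recursion: the dimension
is `-1` iff `M = 0`; it is an ordinal `α` iff it is not smaller than `α` and in every descending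
chain `C 0 ≥ C 1 ≥ ⋯` of submodules of `M` all but finitely many of the factors
`C i / C (i + 1)` have Krull dimension smaller than `α`. -/
def IsModuleKrullDim (R : Type u) [Ring R] (α : WithBot Ordinal.{v}) (M : Type v)
    [AddCommGroup M] [Module R M] : Prop :=
  (∀ β, β < α → ¬ IsModuleKrullDim R β M) ∧
  (α = ⊥ → Subsingleton M) ∧
  (α ≠ ⊥ → ∀ C : ℕ → Submodule R M, Antitone C → ∃ n : ℕ, ∀ i : ℕ, n ≤ i →
    ∃ β, ∃ _ : β < α, IsModuleKrullDim R β (C i ⧸ (C (i + 1)).submoduleOf (C i)))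
termination_by wellFounded_lt.wrap α
decreasing_by all_goals assumption

/-- `M` has Krull dimension: its Krull dimension exists, as `-1` or as an ordinal. -/
def HasModuleKrullDim (R : Type u) (M : Type v) [Ring R] [AddCommGroup M] [Module R M] : Prop :=
  ∃ α : WithBot Ordinal.{v}, IsModuleKrullDim R α M

/-! A module has Krull dimension exactly when its submodule lattice contains no copy of the chain ℚ
(`IsModuleKrullDim.not_hasDenseChain`, `hasModuleKrullDim_of_not_hasDenseChain`), so dense chains
replace ordinals.

Suppose Rad(M) contains such a chain, and let K be a supplement of Rad(M), which AB5* provides.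
Rad(M) ∩ K is small, so the chain survives in Rad(M)/(Rad(M) ∩ K) ≅ M/K. Iterating
`exists_larger_with_hasDenseChain` from K yields an infinite coindependent family of proper
submodules above K. This is impossible (`not_exists_coindependent`): the family gives a copy of the
power set of ℕ, hence of ℚ, inside a small submodule of a factor module of M, and small submodules
of factors inherit the absence of dense chains. -/

/-- The interval `[a, b]` contains a chain isomorphic to the rational numbers. -/
def HasDenseChain {α : Type*} [Preorder α] (a b : α) : Prop :=
  ∃ f : ℚ → α, StrictMono f ∧ ∀ q, a ≤ f q ∧ f q ≤ b

/-! ### Dense chains in modular lattices -/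

namespace HasDenseChain

section Preorder

variable {α β : Type*} [Preorder α] [Preorder β]

theorem mono {a b a' b' : α} (h : HasDenseChain a b) (ha : a' ≤ a) (hb : b ≤ b') :
    HasDenseChain a' b' := by
  obtain ⟨f, hf, h⟩ := h
  exact ⟨f, hf, fun q => ⟨ha.trans (h q).1, (h q).2.trans hb⟩⟩

theorem exists_strictMono_rat_Ioo {p q : ℚ} (h : p < q) :
    ∃ g : ℚ → ℚ, StrictMono g ∧ ∀ x, p < g x ∧ g x < q := by
  have : Nontrivial (Set.Ioo p q) := by
    obtain ⟨r, hr⟩ := exists_between h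
    obtain ⟨s, hs⟩ := exists_between hr.1
    exact ⟨⟨r, hr⟩, ⟨s, hs.1, hs.2.trans hr.2⟩, fun e => hs.2.ne' (congrArg Subtype.val e)⟩
  obtain ⟨e⟩ := Order.embedding_from_countable_to_dense ℚ (Set.Ioo p q)
  exact ⟨fun x => e x, fun x y hxy => e.strictMono hxy, fun x => (e x).2⟩

theorem of_strictMonoOn {f : ℚ → α} {p q : ℚ} (hpq : p < q) (hf : StrictMonoOn f (Set.Icc p q)) :
    HasDenseChain (f p) (f q) := by
  obtain ⟨g, hg, h⟩ := exists_strictMono_rat_Ioo hpq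
  have hp : p ∈ Set.Icc p q := Set.left_mem_Icc.2 hpq.le
  have hq : q ∈ Set.Icc p q := Set.right_mem_Icc.2 hpq.le
  have hx : ∀ x, g x ∈ Set.Icc p q := fun x => ⟨(h x).1.le, (h x).2.le⟩
  exact ⟨f ∘ g, fun x y hxy => hf (hx x) (hx y) (hg hxy),
    fun x => ⟨(hf hp (hx x) (h x).1).le, (hf (hx x) hq (h x).2).le⟩⟩

theorem map {a b : α} {a' b' : β} (h : HasDenseChain a b) (g : α → β)
    (hg : StrictMonoOn g (Set.Icc a b)) (ha : ∀ x ∈ Set.Icc a b, g x ∈ Set.Icc a' b') :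
    HasDenseChain a' b' := by
  obtain ⟨f, hf, h⟩ := h
  exact ⟨g ∘ f, fun p q hpq => hg (h p) (h q) (hf hpq), fun q => ha _ (h q)⟩

end Preorder

/-- If joining with `b` is injective on the chain, its image lies above `b`. Otherwise it collapses
some segment, and by modularity meeting with `b` is strict there. -/
theorem split {α : Type*} [Lattice α] [IsModularLattice α] {a b c : α} (h : HasDenseChain a c)
    (hab : a ≤ b) (hbc : b ≤ c) : HasDenseChain a b ∨ HasDenseChain b c := by
  obtain ⟨f, hf, h⟩ := h
  by_cases H : ∃ p q, p < q ∧ f p ⊔ b = f q ⊔ b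
  · obtain ⟨p, q, hpq, e⟩ := H
    left
    have hs : StrictMonoOn (fun x => f x ⊓ b) (Set.Icc p q) := by
      intro x hx y hy hxy
      refine lt_of_le_of_ne (inf_le_inf_right _ (hf hxy).le) fun e' => (hf hxy).ne ?_
      refine eq_of_le_of_inf_le_of_sup_le (z := b) (hf hxy).le e'.ge ?_
      calc f y ⊔ b ≤ f q ⊔ b := sup_le_sup_right (hf.monotone hy.2) _
        _ = f p ⊔ b := e.symm
        _ ≤ f x ⊔ b := sup_le_sup_right (hf.monotone hx.1) _
    exact (of_strictMonoOn hpq hs).mono (le_inf (h p).1 hab) inf_le_right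
  · right
    push Not at H
    exact ⟨fun q => f q ⊔ b, fun p q hpq =>
      lt_of_le_of_ne (sup_le_sup_right (hf hpq).le _) (H p q hpq),
      fun q => ⟨le_sup_right, sup_le (h q).2 hbc⟩⟩

theorem inf_of_sup {α : Type*} [Lattice α] [IsModularLattice α] {a b : α}
    (h : HasDenseChain b (a ⊔ b)) : HasDenseChain (a ⊓ b) a :=
  h.map (fun c => a ⊓ c) inf_strictMonoOn_Icc_sup
    fun _ hx => ⟨inf_le_inf_left _ hx.1, inf_le_left⟩

/-- If a relation `r` contained in `<` is monotone in both arguments and every instance of it can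
be interpolated, then a dense chain joins any two related elements. -/
theorem of_interpolation {α : Type*} [PartialOrder α] {r : α → α → Prop}
    (hlt : ∀ a b, r a b → a < b) (hmono : ∀ a b a' b', a' ≤ a → b ≤ b' → r a b → r a' b')
    (hdense : ∀ a b, r a b → ∃ c, r a c ∧ r c b) {a b : α} (hab : r a b) :
    HasDenseChain a b := by
  classical
  obtain ⟨T, hT, habT⟩ := (IsChain.pair hab : IsChain r {a, b}).exists_maxChain
  obtain ⟨hchain, hmax⟩ := hT
  have hle : IsChain (· ≤ ·) T := hchain.mono_rel fun x y h => (hlt x y h).le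
  have hr : ∀ {x y}, x ∈ T → y ∈ T → x < y → r x y := fun hx hy hxy =>
    (hchain hx hy hxy.ne).resolve_right fun h => (hlt _ _ h).not_gt hxy
  let _ : LinearOrder T := hle.linearOrder
  have hltT : ∀ x y : T, x < y → x.1 < y.1 := fun x y h =>
    lt_of_le_of_ne h.le fun e => h.ne (Subtype.ext e)
  have hTlt : ∀ x y : T, x.1 < y.1 → x < y := fun x y h =>
    lt_of_le_of_ne (show x.1 ≤ y.1 from h.le) fun e => h.ne (congrArg Subtype.val e)
  have : DenselyOrdered T := by
    refine ⟨fun x y hxy => ?_⟩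
    obtain ⟨c, hxc, hcy⟩ := hdense _ _ (hr x.2 y.2 (hltT _ _ hxy))
    by_cases hc : c ∈ T
    · exact ⟨⟨c, hc⟩, hTlt _ _ (hlt _ _ hxc), hTlt _ _ (hlt _ _ hcy)⟩
    -- With no member of `T` strictly between `x` and `y`, the interpolant `c` could be added to the
    -- maximal chain.
    by_contra! hno
    have hins : IsChain r (insert c T) := by
      refine hchain.insert fun z hz _ => ?_
      rcases le_or_gt (⟨z, hz⟩ : T) x with hzx | hzx
      · exact Or.inr (hmono _ _ _ _ hzx le_rfl hxc)
      · exact Or.inl (hmono _ _ _ _ le_rfl (hno _ hzx) hcy)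
    exact hc (hmax hins (Set.subset_insert _ _) ▸ Set.mem_insert _ _)
  let a' : T := ⟨a, habT (by simp)⟩
  let b' : T := ⟨b, habT (by simp)⟩
  have hab' : a' < b' := hTlt _ _ (hlt _ _ hab)
  have : Nontrivial (Set.Icc a' b') :=
    ⟨⟨a', le_rfl, hab'.le⟩, ⟨b', hab'.le, le_rfl⟩, fun e => hab'.ne (congrArg Subtype.val e)⟩
  obtain ⟨e⟩ := Order.embedding_from_countable_to_dense ℚ (Set.Icc a' b')
  exact ⟨fun q => (e q).1.1, fun p q hpq => hltT _ _ (e.strictMono hpq), fun q => (e q).2⟩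

end HasDenseChain

/-! ### Krull dimension and dense chains -/

section Krull

variable {R : Type u} [Ring R]

section Interval

variable {X : Type v} [AddCommGroup X] [Module R X]

theorem submoduleOf_strictMonoOn_Iic (b : Submodule R X) :
    StrictMonoOn (fun s : Submodule R X => s.submoduleOf b) (Set.Iic b) := by
  intro s hs t ht hst
  refine lt_of_le_of_ne (Submodule.comap_mono hst.le) fun e => hst.ne ?_
  have : (s.comap b.subtype).map b.subtype = (t.comap b.subtype).map b.subtype :=
    congrArg (Submodule.map b.subtype) e
  rwa [Submodule.map_comap_subtype,
    Submodule.map_comap_subtype, inf_eq_right.2 (show s ≤ b from hs),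
    inf_eq_right.2 (show t ≤ b from ht)] at this

theorem HasDenseChain.subquotient {a b : Submodule R X} (h : HasDenseChain a b) :
    HasDenseChain (⊥ : Submodule R (b ⧸ a.submoduleOf b)) ⊤ := by
  refine (h.map (a' := a.submoduleOf b) (b' := ⊤) (fun s => s.submoduleOf b)
    ((submoduleOf_strictMonoOn_Iic b).mono fun s hs => hs.2)
    fun s hs => ⟨Submodule.comap_mono hs.1, le_top⟩).map
      (Submodule.map (a.submoduleOf b).mkQ) ?_ fun _ _ => ⟨bot_le, le_top⟩
  intro s hs t ht hst
  refine lt_of_le_of_ne (Submodule.map_mono hst.le) fun e => hst.ne ?_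
  have := congrArg (Submodule.comap (a.submoduleOf b).mkQ) e
  simpa [Submodule.comap_map_mkQ, sup_eq_right.2 hs.1, sup_eq_right.2 ht.1] using this

theorem exists_strictMono_of_subquotient (a b : Submodule R X) (hab : a ≤ b) :
    ∃ g : Submodule R (b ⧸ a.submoduleOf b) → Submodule R X,
      StrictMono g ∧ ∀ s, a ≤ g s ∧ g s ≤ b := by
  refine ⟨fun s => (s.comap (a.submoduleOf b).mkQ).map b.subtype, ?_, fun s => ⟨?_, ?_⟩⟩
  · exact (Submodule.map_strictMono_of_injective b.injective_subtype).comp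
      (Monotone.strictMono_of_injective (fun _ _ h => Submodule.comap_mono h)
        (Submodule.comap_injective_of_surjective (Submodule.mkQ_surjective _)))
  · intro x hx
    refine ⟨⟨x, hab hx⟩, ?_, rfl⟩
    have : (a.submoduleOf b).mkQ ⟨x, hab hx⟩ = 0 :=
      (Submodule.Quotient.mk_eq_zero _).2 hx
    simp [this]
  · exact Submodule.map_subtype_le _ _

end Interval

theorem IsModuleKrullDim.not_hasDenseChain {α : WithBot Ordinal.{v}} {X : Type v}
    [AddCommGroup X] [Module R X] (h : IsModuleKrullDim R α X) :
    ¬ HasDenseChain (⊥ : Submodule R X) ⊤ := by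
  induction α using WellFoundedLT.induction generalizing X with
  | ind α ih =>
    rintro ⟨f, hf, -⟩
    rw [IsModuleKrullDim] at h
    obtain ⟨-, h0, h1⟩ := h
    by_cases hα : α = ⊥
    · have := h0 hα
      exact (hf zero_lt_one).ne (Subsingleton.elim _ _)
    · obtain ⟨n, hn⟩ := h1 hα (fun i => f (-(i : ℚ)))
        (fun i j hij => hf.monotone (by simpa using hij))
      obtain ⟨β, hβ, hK⟩ := hn n le_rfl
      refine ih β hβ hK (HasDenseChain.subquotient ?_)
      exact HasDenseChain.of_strictMonoOn (by simp) (hf.strictMonoOn _)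

theorem HasModuleKrullDim.not_hasDenseChain {X : Type v} [AddCommGroup X] [Module R X]
    {N : Submodule R X} (h : HasModuleKrullDim R N) : ¬ HasDenseChain ⊥ N := by
  obtain ⟨α, h⟩ := h
  exact fun hN => h.not_hasDenseChain (hN.map (fun s => s.submoduleOf N)
    ((submoduleOf_strictMonoOn_Iic N).mono fun s hs => hs.2) fun _ _ => ⟨bot_le, le_top⟩)

theorem hasModuleKrullDim_of_chain_condition {X : Type v} [AddCommGroup X] [Module R X]
    {α : WithBot Ordinal.{v}} (hα : α ≠ ⊥)
    (h : ∀ C : ℕ → Submodule R X, Antitone C → ∃ n : ℕ, ∀ i : ℕ, n ≤ i →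
      ∃ β, ∃ _ : β < α, IsModuleKrullDim R β (C i ⧸ (C (i + 1)).submoduleOf (C i))) :
    HasModuleKrullDim R X := by
  by_cases H : ∃ β, β < α ∧ IsModuleKrullDim R β X
  · obtain ⟨β, -, hβ⟩ := H
    exact ⟨β, hβ⟩
  · push Not at H
    refine ⟨α, ?_⟩
    rw [IsModuleKrullDim]
    exact ⟨H, fun e => (hα e).elim, fun _ => h⟩

theorem nontrivial_of_not_hasModuleKrullDim {X : Type v} [AddCommGroup X] [Module R X]
    (h : ¬ HasModuleKrullDim R X) : Nontrivial X := by
  by_contra hX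
  rw [not_nontrivial_iff_subsingleton] at hX
  refine h ⟨⊥, ?_⟩
  rw [IsModuleKrullDim]
  exact ⟨fun β hβ => (not_lt_bot hβ).elim, fun _ => hX, fun h => (h rfl).elim⟩

theorem exists_antitone_of_not_hasModuleKrullDim {X : Type v} [AddCommGroup X] [Module R X]
    (h : ¬ HasModuleKrullDim R X) : ∃ C : ℕ → Submodule R X, Antitone C ∧
      ∀ n, ∃ i, n ≤ i ∧ ¬ HasModuleKrullDim R (C i ⧸ (C (i + 1)).submoduleOf (C i)) := by
  classical
  by_contra! H
  -- Pairs of submodules form a type in universe `v`, so the dimensions have a supremum in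
  -- `Ordinal.{v}`. The value 0 replaces both `⊥` and missing dimensions.
  let d : Submodule R X × Submodule R X → Ordinal.{v} := fun p =>
    if hp : HasModuleKrullDim R (p.2 ⧸ p.1.submoduleOf p.2) then hp.choose.unbotD 0 else 0
  refine h (hasModuleKrullDim_of_chain_condition (α := ((⨆ p, d p) + 1 : Ordinal.{v}))
    (WithBot.coe_ne_bot) fun C hC => ?_)
  obtain ⟨n, hn⟩ := H C hC
  refine ⟨n, fun i hi => ⟨(hn i hi).choose, ?_, (hn i hi).choose_spec⟩⟩
  have hd : d (C (i + 1), C i) = (hn i hi).choose.unbotD 0 := dif_pos (hn i hi)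
  have hle : d (C (i + 1), C i) ≤ ⨆ p, d p := Ordinal.le_iSup d _
  rw [hd] at hle
  generalize (hn i hi).choose = β at hle
  cases β with
  | bot => exact WithBot.bot_lt_coe _
  | coe β => exact WithBot.coe_lt_coe.2 (Order.lt_add_one_iff.2 hle)

/-- Some module without Krull dimension has its submodule lattice embedded in `[a, b]`. -/
def HasBadSection {X : Type v} [AddCommGroup X] [Module R X] (a b : Submodule R X) : Prop :=
  ∃ (Q : Type v) (_ : AddCommGroup Q) (_ : Module R Q) (g : Submodule R Q → Submodule R X),
    ¬ HasModuleKrullDim R Q ∧ StrictMono g ∧ ∀ s, a ≤ g s ∧ g s ≤ b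

/-- A chain witnessing failure has infinitely many bad factors; cutting between two of them leaves
one on each side. -/
theorem HasBadSection.split {X : Type v} [AddCommGroup X] [Module R X] {a b : Submodule R X}
    (h : HasBadSection a b) : ∃ c, HasBadSection a c ∧ HasBadSection c b := by
  obtain ⟨Q, _, _, g, hQ, hg, hab⟩ := h
  obtain ⟨C, hC, hbad⟩ := exists_antitone_of_not_hasModuleKrullDim hQ
  obtain ⟨i, -, hi⟩ := hbad 0
  obtain ⟨j, hij, hj⟩ := hbad (i + 1)
  obtain ⟨gi, hgi, hgi'⟩ := exists_strictMono_of_subquotient _ _ (hC (Nat.le_succ i))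
  obtain ⟨gj, hgj, hgj'⟩ := exists_strictMono_of_subquotient _ _ (hC (Nat.le_succ j))
  refine ⟨g (C (i + 1)), ⟨_, _, _, g ∘ gj, hj, hg.comp hgj, fun s => ⟨(hab _).1, ?_⟩⟩,
    ⟨_, _, _, g ∘ gi, hi, hg.comp hgi, fun s => ⟨?_, (hab _).2⟩⟩⟩
  · exact hg.monotone ((hgj' s).2.trans (hC hij))
  · exact hg.monotone (hgi' s).1

theorem HasBadSection.hasDenseChain {X : Type v} [AddCommGroup X] [Module R X]
    {a b : Submodule R X} (h : HasBadSection a b) : HasDenseChain a b := by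
  refine HasDenseChain.of_interpolation (r := HasBadSection) ?_ ?_
    (fun a b h => h.split) h
  · rintro a b ⟨Q, _, _, g, hQ, hg, hab⟩
    have := nontrivial_of_not_hasModuleKrullDim hQ
    exact (hab ⊥).1.trans_lt ((hg bot_lt_top).trans_le (hab ⊤).2)
  · rintro a b a' b' ha hb ⟨Q, _, _, g, hQ, hg, hab⟩
    exact ⟨Q, _, _, g, hQ, hg, fun s => ⟨ha.trans (hab s).1, (hab s).2.trans hb⟩⟩

/-- A submodule without dense chains of submodules has Krull dimension. -/
theorem hasModuleKrullDim_of_not_hasDenseChain {X : Type v} [AddCommGroup X] [Module R X]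
    {N : Submodule R X} (h : ¬ HasDenseChain ⊥ N) : HasModuleKrullDim R N := by
  by_contra hN
  refine h (HasBadSection.hasDenseChain ⟨N, _, _, Submodule.map N.subtype, hN,
    Submodule.map_strictMono_of_injective N.injective_subtype,
    fun s => ⟨bot_le, Submodule.map_subtype_le _ _⟩⟩)

end Krull

/-! ### Coindependent families in modular lattices -/

section Coindependent

variable {α : Type*} [CompleteLattice α] [IsModularLattice α]

theorem inf_sup_eq_of_sup_eq_top {b c d : α} (hcb : c ≤ b) (h : d ⊔ c = ⊤) : d ⊓ b ⊔ c = b := by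
  rw [sup_comm, ← sup_inf_assoc_of_le _ hcb, sup_comm, h, top_inf_eq]

/-- If `A` is increasing with `A n ≤ B n`, and `A (n + 1)` and `B n` span the whole lattice, then
the infimum of the first `n` terms of `B` spans the lattice with `A n`. -/
theorem iInf_lt_sup_eq_top {A B : ℕ → α} (hAB : ∀ n, A n ≤ B n) (hA : Monotone A)
    (hsup : ∀ n, A (n + 1) ⊔ B n = ⊤) (n : ℕ) : (⨅ i, ⨅ _ : i < n, B i) ⊔ A n = ⊤ := by
  induction n with
  | zero => simp
  | succ n ih =>
    rw [Nat.iInf_lt_succ, eq_top_iff, ← hsup n]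
    exact sup_le le_sup_right ((inf_sup_eq_of_sup_eq_top (hAB n) ih).ge.trans
      (sup_le le_sup_left ((hA n.le_succ).trans le_sup_right)))

theorem iInf_lt_ne_sup_eq_top {A B : ℕ → α} (hAB : ∀ n, A n ≤ B n) (hA : Monotone A)
    (hsup : ∀ n, A (n + 1) ⊔ B n = ⊤) (j n : ℕ) :
    (⨅ i, ⨅ _ : i < n, ⨅ _ : i ≠ j, B i) ⊔ B j = ⊤ := by
  have hD : ∀ n, (⨅ i, ⨅ _ : i < n, B i) ⊔ B n = ⊤ := fun n =>
    eq_top_iff.2 ((iInf_lt_sup_eq_top hAB hA hsup n).ge.trans (sup_le_sup_left (hAB n) _))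
  induction n with
  | zero => simp
  | succ n ih =>
    rw [Nat.iInf_lt_succ]
    rcases lt_trichotomy n j with hn | rfl | hn
    · refine eq_top_iff.2 ((hD j).ge.trans (sup_le_sup_right (le_inf ?_ ?_) _))
      · exact le_iInf fun i => le_iInf fun hi => le_iInf fun _ =>
          iInf₂_le (f := fun i (_ : i < j) => B i) i (hi.trans hn)
      · exact le_iInf fun _ => iInf₂_le n hn
    · simpa using ih
    · rw [eq_top_iff, ← ih, iInf_pos hn.ne']
      refine sup_le ?_ le_sup_right
      -- The partial infimum over all `i < n` lies below the one omitting `j` and spans with `B n`.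
      -- By modularity, the latter is its own meet with `B n` joined with the former, which lies
      -- below `B j`.
      have hDE : (⨅ i, ⨅ _ : i < n, B i) ≤ ⨅ i, ⨅ _ : i < n, ⨅ _ : i ≠ j, B i :=
        iInf_mono fun i => iInf_mono fun _ => le_iInf fun _ => le_rfl
      have := inf_sup_eq_of_sup_eq_top hDE (sup_comm (B n) _ ▸ hD n)
      conv_lhs => rw [← this]
      rw [inf_comm]
      exact sup_le_sup_left (iInf₂_le j hn) _

end Coindependent

/-! ### Supplements, smallness and the radical under AB5* -/

variable {R : Type u} {M : Type v} [Ring R] [AddCommGroup M] [Module R M]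

/-- `T / K` is a small submodule of `M / K`. -/
def IsSmallOver (K T : Submodule R M) : Prop :=
  ∀ Y : Submodule R M, K ≤ Y → T ⊔ Y = ⊤ → Y = ⊤

theorem HasAB5Star.sup_iInf (hAB : HasAB5Star R M) (N : Submodule R M) {S : ℕ → Submodule R M}
    (hS : Antitone S) : N ⊔ ⨅ n, S n = ⨅ n, N ⊔ S n := by
  have := hAB N (Set.range S) (by
    rintro _ ⟨i, rfl⟩ _ ⟨j, rfl⟩
    exact ⟨S (max i j), ⟨_, rfl⟩, hS (le_max_left i j), hS (le_max_right i j)⟩)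
  rwa [sInf_range, iInf_range] at this

/-- Supplements exist, above any given lower bound and below any given complement. -/
theorem HasAB5Star.exists_supplement (hAB : HasAB5Star R M) {X Z : Submodule R M}
    (L : Submodule R M) (hXZ : X ⊔ Z = ⊤) (hLZ : L ≤ Z) : ∃ K, L ≤ K ∧ K ≤ Z ∧ X ⊔ K = ⊤ ∧
      ∀ Y, L ≤ Y → Y ≤ K → X ⊔ Y = ⊤ → Y = K := by
  obtain ⟨m, hm, hmax⟩ := zorn_le_nonempty₀ (α := (Submodule R M)ᵒᵈ)
    {Y | L ≤ OrderDual.ofDual Y ∧ X ⊔ OrderDual.ofDual Y = ⊤} (by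
      intro c hc hchain y hy
      refine ⟨OrderDual.toDual (sInf (OrderDual.toDual ⁻¹' c)), ⟨?_, ?_⟩, ?_⟩
      · exact le_sInf fun Y hY => (hc hY).1
      · change X ⊔ sInf (OrderDual.toDual ⁻¹' c) = ⊤
        rw [hAB]
        · exact iInf₂_eq_top.2 fun Y hY => (hc hY).2
        · intro a ha b hb
          rcases hchain.total ha hb with h | h
          · exact ⟨b, hb, h, le_rfl⟩
          · exact ⟨a, ha, le_rfl, h⟩
      · exact fun z hz => sInf_le (show OrderDual.ofDual z ∈ OrderDual.toDual ⁻¹' c from hz))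
    (OrderDual.toDual Z) ⟨hLZ, hXZ⟩
  exact ⟨OrderDual.ofDual m, hmax.1.1, hm, hmax.1.2, fun Y hLY hY hXY =>
    le_antisymm hY (hmax.2 (y := OrderDual.toDual Y) ⟨hLY, hXY⟩ hY)⟩

theorem inf_isSmallOver_of_minimal {L X K : Submodule R M} (hXK : X ⊔ K = ⊤) (hLK : L ≤ K)
    (hmin : ∀ Y, L ≤ Y → Y ≤ K → X ⊔ Y = ⊤ → Y = K) : IsSmallOver L (X ⊓ K) := by
  intro Y hLY hY
  have h1 : K ⊓ Y ⊔ X ⊓ K = K := by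
    rw [sup_comm, inf_comm K Y, ← sup_inf_assoc_of_le _ inf_le_right, hY, top_inf_eq]
  have h2 : K ⊓ Y = K := by
    refine hmin _ (le_inf hLK hLY) inf_le_left ?_
    rw [eq_top_iff, ← hXK]
    refine sup_le le_sup_left ?_
    conv_lhs => rw [← h1]
    exact sup_le le_sup_right (inf_le_left.trans le_sup_left)
  have h3 : X ⊓ K ≤ Y := inf_le_right.trans (inf_eq_left.1 h2)
  rwa [sup_eq_right.2 h3] at hY

/-- Absence of dense chains in small submodules passes to the factor modules. -/
theorem IsSmallOver.not_hasDenseChain (hAB : HasAB5Star R M)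
    (hsmall : ∀ N : Submodule R M, IsSmallSubmodule N → ¬ HasDenseChain ⊥ N)
    {K T : Submodule R M} (hKT : K ≤ T) (hT : IsSmallOver K T) : ¬ HasDenseChain K T := by
  -- A supplement `K'` of `K` maps onto `M / K`; then `T ⊓ K'` is small in `M` and maps onto `T /
  -- K`.
  obtain ⟨K', -, -, hKK', hmin⟩ := hAB.exists_supplement (X := K) (Z := ⊤) ⊥ (by simp) bot_le
  have hT' : IsSmallSubmodule (T ⊓ K') := by
    intro Y hY
    have h1 : T ⊓ K' ⊔ K' ⊓ Y = K' := by
      rw [inf_comm K' Y, ← sup_inf_assoc_of_le _ inf_le_right, hY, top_inf_eq]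
    have h2 : K ⊔ (K' ⊓ Y) = ⊤ := by
      refine hT _ le_sup_left ?_
      rw [eq_top_iff, ← hKK']
      conv_lhs => rw [← h1]
      refine sup_le (le_sup_left.trans le_sup_right) (sup_le ?_ ?_)
      · exact inf_le_left.trans le_sup_left
      · exact le_sup_right.trans le_sup_right
    have h3 : K' ≤ Y := inf_eq_left.1 (hmin _ bot_le inf_le_left h2)
    rwa [sup_eq_right.2 (inf_le_right.trans h3)] at hY
  intro h
  refine hsmall _ hT' (HasDenseChain.mono (HasDenseChain.inf_of_sup (b := K) ?_) bot_le le_rfl)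
  refine h.mono le_rfl ?_
  rw [sup_comm, inf_comm, ← sup_inf_assoc_of_le _ hKT, hKK', top_inf_eq]

theorem IsSmallSubmodule.mono {N N' : Submodule R M} (h : IsSmallSubmodule N) (hN : N' ≤ N) :
    IsSmallSubmodule N' :=
  fun K hK => h K (eq_top_iff.2 (hK.ge.trans (sup_le_sup_right hN _)))

theorem IsSmallSubmodule.sup {N N' : Submodule R M} (h : IsSmallSubmodule N)
    (h' : IsSmallSubmodule N') : IsSmallSubmodule (N ⊔ N') :=
  fun K hK => h' K (h _ (sup_assoc N N' K ▸ hK))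

theorem isSmallSubmodule_span_of_mem_moduleRad {x : M} (hx : x ∈ moduleRad R M) :
    IsSmallSubmodule (Submodule.span R {x}) := by
  have hbot : IsSmallSubmodule (⊥ : Submodule R M) := fun K hK => bot_sup_eq K ▸ hK
  have hdir : DirectedOn (· ≤ ·) {N : Submodule R M | IsSmallSubmodule N} := fun N hN N' hN' =>
    ⟨N ⊔ N', IsSmallSubmodule.sup hN hN', le_sup_left, le_sup_right⟩
  obtain ⟨N, hN, hxN⟩ := (Submodule.mem_sSup_of_directed ⟨⊥, hbot⟩ hdir).1 hx
  exact IsSmallSubmodule.mono hN ((Submodule.span_singleton_le_iff_mem x N).2 hxN)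

/-- Below a submodule that spans `M` with the radical, cyclic submodules can be cancelled. -/
theorem eq_top_of_span_singleton_sup {K Y : Submodule R M} (hK : moduleRad R M ⊔ K = ⊤)
    (hKY : K ≤ Y) {x : M} (h : Submodule.span R {x} ⊔ Y = ⊤) : Y = ⊤ := by
  obtain ⟨p, hp, k, hk, rfl⟩ :=
    Submodule.mem_sup.1 (hK ▸ Submodule.mem_top : x ∈ moduleRad R M ⊔ K)
  refine isSmallSubmodule_span_of_mem_moduleRad hp Y (eq_top_iff.2 (h.ge.trans ?_))
  refine sup_le ?_ le_sup_right
  rw [Submodule.span_singleton_le_iff_mem]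
  exact add_mem (Submodule.mem_sup_left (Submodule.mem_span_singleton_self p))
    (Submodule.mem_sup_right (hKY hk))

/-- A factor module of `M` by a submodule spanning `M` with the radical has no infinite
coindependent family of proper submodules. -/
theorem not_exists_coindependent (hAB : HasAB5Star R M)
    (hsmall : ∀ N : Submodule R M, IsSmallSubmodule N → ¬ HasDenseChain ⊥ N)
    {K : Submodule R M} (hK : moduleRad R M ⊔ K = ⊤) {B : ℕ → Submodule R M}
    (hKB : ∀ n, K ≤ B n) (hB : ∀ n, B n ≠ ⊤)
    (hco : ∀ j n, (⨅ i, ⨅ _ : i < n, ⨅ _ : i ≠ j, B i) ⊔ B j = ⊤) : False := by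
  -- AB5* extends coindependence from finite to infinite intersections.
  have hx : ∀ j, ∃ x, (∀ i, i ≠ j → x ∈ B i) ∧ x ∉ B j := by
    intro j
    have h : B j ⊔ ⨅ n, ⨅ i, ⨅ _ : i < n, ⨅ _ : i ≠ j, B i = ⊤ := by
      rw [hAB.sup_iInf]
      · exact iInf_eq_top.2 fun n => by rw [sup_comm, hco]
      · exact fun m n hmn => iInf_mono fun i => le_iInf fun hi => iInf_le _ (hi.trans_le hmn)
    by_contra! hno
    refine hB j (top_le_iff.1 (h.ge.trans (sup_le le_rfl fun x hx => hno x fun i hij => ?_)))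
    simp only [Submodule.mem_iInf] at hx
    exact hx (i + 1) i i.lt_succ_self hij
  choose x hxB hxn using hx
  set L := ⨅ i, B i
  have hKL : K ≤ L := le_iInf hKB
  let N : Set ℕ → Submodule R M := fun s => L ⊔ Submodule.span R (x '' s)
  have hN : Monotone N := fun s t hst =>
    sup_le_sup_left (Submodule.span_mono (Set.image_mono hst)) _
  have hNB : ∀ s i, i ∉ s → N s ≤ B i := fun s i hi => by
    refine sup_le (iInf_le _ _) (Submodule.span_le.2 ?_)
    rintro _ ⟨j, hj, rfl⟩
    exact hxB j i fun e => hi (e ▸ hj)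
  have hxN : ∀ s i, i ∈ s → x i ∈ N s := fun s i hi =>
    Submodule.mem_sup_right (Submodule.subset_span ⟨i, hi, rfl⟩)
  have hlt : StrictMono N := fun s t hst => by
    obtain ⟨i, hit, his⟩ := Set.exists_of_ssubset hst
    exact lt_of_le_of_ne (hN hst.le) fun e => hxn i (hNB s i his (e ▸ hxN t i hit))
  have hsm : IsSmallOver L (N Set.univ) := by
    intro Y hLY hY
    -- Finitely many generators can be cancelled, and the tails meet inside `L`, so AB5* forces `Y =
    -- ⊤`.
    have htail : ∀ n, Y ⊔ N (Set.Ici n) = ⊤ := by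
      intro n
      induction n with
      | zero =>
        have : Set.Ici 0 = (Set.univ : Set ℕ) := by ext; simp
        rw [this, sup_comm, hY]
      | succ n ih =>
        refine eq_top_of_span_singleton_sup (x := x n) hK ((hKL.trans hLY).trans le_sup_left)
          (eq_top_iff.2 (ih.ge.trans ?_))
        refine sup_le (le_sup_left.trans le_sup_right) (sup_le ?_ (Submodule.span_le.2 ?_))
        · exact hLY.trans (le_sup_left.trans le_sup_right)
        · rintro _ ⟨i, hi, rfl⟩
          rcases (show n ≤ i from hi).eq_or_lt with rfl | hlt
          · exact Submodule.mem_sup_left (Submodule.mem_span_singleton_self _)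
          · exact Submodule.mem_sup_right (Submodule.mem_sup_right (hxN _ _ hlt))
    have h := hAB.sup_iInf Y (S := fun n => N (Set.Ici n))
      fun m n hmn => hN (Set.Ici_subset_Ici.2 hmn)
    have hinf : ⨅ n, N (Set.Ici n) ≤ Y :=
      le_trans (le_iInf fun i => (iInf_le _ (i + 1)).trans (hNB _ i (by simp))) hLY
    rw [sup_eq_left.2 hinf] at h
    exact h.trans (iInf_eq_top.2 htail)
  refine hsm.not_hasDenseChain hAB hsmall le_sup_left ?_
  obtain ⟨e⟩ := nonempty_equiv_of_countable (α := ℕ) (β := ℚ)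
  refine ⟨fun q => N (e ⁻¹' Set.Iio q), fun p q hpq => hlt ?_, fun q =>
    ⟨le_sup_left, hN (Set.subset_univ _)⟩⟩
  refine (Set.ssubset_iff_of_subset fun i hi => lt_trans hi hpq).2 ⟨e.symm p, ?_, ?_⟩
  · change e (e.symm p) < q
    rwa [e.apply_symm_apply]
  · change ¬ e (e.symm p) < p
    rw [e.apply_symm_apply]
    exact lt_irrefl p

/-- A submodule `X` with a dense chain over `A` is not small over `A`, so it has a proper supplement
`C` above `A`. As `X ⊓ C` is small over `A`, the chain passes to `[X ⊓ C, ⊤]`, then to `[X, ⊤]` or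
`[C, ⊤]`; `X` and `C` take the two roles accordingly. -/
theorem exists_larger_with_hasDenseChain (hAB : HasAB5Star R M)
    (hsmall : ∀ N : Submodule R M, IsSmallSubmodule N → ¬ HasDenseChain ⊥ N)
    {A : Submodule R M} (hA : HasDenseChain A ⊤) :
    ∃ A' B, A ≤ A' ∧ A ≤ B ∧ B ≠ ⊤ ∧ A' ⊔ B = ⊤ ∧ HasDenseChain A' ⊤ := by
  obtain ⟨X, hAX, hX, hXD⟩ : ∃ X, A ≤ X ∧ X ≠ ⊤ ∧ HasDenseChain A X := by
    obtain ⟨f, hf, hfA⟩ := hA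
    exact ⟨f 1, (hfA 1).1, ((hf one_lt_two).trans_le le_top).ne,
      (HasDenseChain.of_strictMonoOn zero_lt_one (hf.strictMonoOn _)).mono (hfA 0).1 le_rfl⟩
  obtain ⟨Z, hAZ, hXZ, hZ⟩ : ∃ Z, A ≤ Z ∧ X ⊔ Z = ⊤ ∧ Z ≠ ⊤ := by
    by_contra! hno
    exact IsSmallOver.not_hasDenseChain hAB hsmall hAX hno hXD
  obtain ⟨C, hAC, hCZ, hXC, hmin⟩ := hAB.exists_supplement A hXZ hAZ
  have hC : C ≠ ⊤ := fun e => hZ (top_le_iff.1 (e ▸ hCZ))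
  have hinf := (inf_isSmallOver_of_minimal hXC hAC hmin).not_hasDenseChain hAB hsmall
    (le_inf hAX hAC)
  rcases (hA.split (le_inf hAX hAC) le_top).resolve_left hinf |>.split inf_le_right le_top with h | h
  · refine ⟨X, C, hAX, hAC, hC, hXC, ?_⟩
    have : HasDenseChain (C ⊓ X) C := inf_comm X C ▸ h
    refine (this.map (fun c => c ⊔ X) sup_strictMonoOn_Icc_inf
      (a' := X) (b' := ⊤) fun _ _ => ⟨le_sup_right, le_top⟩)
  · exact ⟨C, X, hAC, hAX, hX, sup_comm X C ▸ hXC, h⟩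

theorem not_hasDenseChain_moduleRad (hAB : HasAB5Star R M)
    (hsmall : ∀ N : Submodule R M, IsSmallSubmodule N → ¬ HasDenseChain ⊥ N) :
    ¬ HasDenseChain ⊥ (moduleRad R M) := by
  intro hD
  obtain ⟨K, -, -, hK, hmin⟩ :=
    hAB.exists_supplement (X := moduleRad R M) (Z := ⊤) ⊥ (by simp) bot_le
  have hsm : IsSmallSubmodule (moduleRad R M ⊓ K) := fun Y =>
    inf_isSmallOver_of_minimal hK bot_le hmin Y bot_le
  have hKD : HasDenseChain K ⊤ :=
    ((hD.split bot_le inf_le_left).resolve_left (hsmall _ hsm)).map (fun c => c ⊔ K)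
      sup_strictMonoOn_Icc_inf fun _ _ => ⟨le_sup_right, le_top⟩
  choose! F G hF hG hGtop hFG hFD using
    fun (A : Submodule R M) (hA : HasDenseChain A ⊤) =>
      exists_larger_with_hasDenseChain hAB hsmall hA
  let A : ℕ → Submodule R M := fun n => F^[n] K
  have hAs : ∀ n, A (n + 1) = F (A n) := fun n => Function.iterate_succ_apply' F n K
  have hAD : ∀ n, HasDenseChain (A n) ⊤ := by
    intro n
    induction n with
    | zero => exact hKD
    | succ n ih => exact hAs n ▸ hFD _ ih
  have hAmono : Monotone A := monotone_nat_of_le_succ fun n => hAs n ▸ hF _ (hAD n)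
  have hAG : ∀ n, A n ≤ G (A n) := fun n => hG _ (hAD n)
  refine not_exists_coindependent hAB hsmall hK (B := fun n => G (A n))
    (fun n => (hAmono n.zero_le).trans (hAG n)) (fun n => hGtop _ (hAD n))
    (iInf_lt_ne_sup_eq_top hAG hAmono fun n => hAs n ▸ hFG _ (hAD n))

theorem theorem7 {R : Type u} {M : Type v} [Ring R] [AddCommGroup M] [Module R M]
    (hAB : HasAB5Star R M)
    (hsmall : ∀ N : Submodule R M, IsSmallSubmodule N → HasModuleKrullDim R N) :
    HasModuleKrullDim R (moduleRad R M) :=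
  hasModuleKrullDim_of_not_hasDenseChain
    (not_hasDenseChain_moduleRad hAB fun N hN => (hsmall N hN).not_hasDenseChain)
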